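/- Work in the first-order language $\mathcal{L}$ of set theory, whose only nonlogical symbol is $\in$. Let $\mathrm{ZF}^-$ be the theory with axioms Extensionality, Emptyset, Pair, Union, Infinity, Transitive Containment (every set is a subset of a transitive set), Set Foundation, $\Delta_0$-Separation, $\Pi_1$-Foundation, and the Collection scheme for all $\mathcal{L}$-formulae ($\mathrm{ZF}$ without Powerset, axiomatised with Collection). Let $\mathrm{WO}$ be the axiom that every set can be well-ordered. For an ordinal $\alpha$, let $\Pi^1_\infty\text{-}\mathrm{DC}_\alpha$ be the scheme asserting, for every $\mathcal{L}$-formula $\phi(x,y,\vec z)$ and all parameters $\vec z$: if for every $\gamma\in\alpha$ and every function $g$ with $\mathrm{dom}(g)=\gamma$ there is $y$ with $\phi(g,y,\vec z)$, then there is a function $f$ with $\mathrm{dom}(f)=\alpha$ such that $\phi(f\upharpoonright\beta, f(\beta),\vec z)$ for all $\beta\in\alpha$. For an $\mathcal{L}$-structure $\mathcal{M}=\langle M,\in^{\mathcal{M}}\rangle$, let $\mathrm{WF}(M)$ (its well-founded part) be the set of all $x\in M$ for which there is no sequence $f:\omega\to M$ (in the metatheory) with $f(0)=x$ and $f(n+1)\in^{\mathcal{M}}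 f(n)$ for all $n\in\omega$. For $c\in M$ let $c^*=\{x\in M \mid \mathcal{M}\models x\in c\}$. **Theorem.** Let $\mathcal{M}$ be a model of $\mathrm{ZF}^-+\mathrm{WO}+\forall\alpha\,\Pi^1_\infty\text{-}\mathrm{DC}_\alpha$. If the well-founded part of $\mathcal{M}$ is c-bounded in $\mathcal{M}$, i.e. there is $x\in M$ such that $\mathcal{M}\models |w|<|x|$ for all $w\in\mathrm{WF}(M)$, then the well-founded part of $\mathcal{M}$ is contained, i.e. there is $c\in M$ such that $\mathrm{WF}(M)\subseteq c^*$. -/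

import Mathlib

namespace SetModel

/-! ### The language of set theory and its structures -/

/-- The only nonlogical symbol: binary membership. -/
inductive SetRel : ℕ → Type
  | mem : SetRel 2

/-- The first-order language of set theory. -/
def setLang : FirstOrder.Language.{0, 0} := ⟨fun _ => Empty, SetRel⟩

/-- The membership symbol. -/
abbrev memSymb : setLang.Relations 2 := SetRel.mem

/-- `x ∈ᴹ y` says that `M ⊨ x ∈ y`. -/
def Mem {M : Type*} [setLang.Structure M] (x y : M) : Prop :=
  FirstOrder.Language.Structure.RelMap memSymb ![x, y]

infix:50 " ∈ᴹ " => Mem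

/-! ### Classes of formulae

A formula `φ : setLang.BoundedFormula (Fin p) n` is read as `φ(x₁, …, xₙ, z₁, …, z_p)`, the
variables `z` being parameters. -/

/-- A class of formulae of the language of set theory. -/
abbrev FormulaClass := ∀ p n : ℕ, setLang.BoundedFormula (Fin p) n → Prop

/-- The formula `x ∈ y`, where `x` is the variable about to be quantified and `y` is one of the
variables that are already present. -/
def memBound {p n : ℕ} (y : Fin p ⊕ Fin n) : setLang.BoundedFormula (Fin p) (n + 1) :=
  FirstOrder.Language.Relations.boundedFormula₂ memSymb
    (FirstOrder.Language.Term.var (Sum.inr (Fin.last n)))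
    (FirstOrder.Language.Term.var (Sum.map id Fin.castSucc y))

/-- `Δ₀` formulae: the least class that contains the atomic formulae and is closed under the
connectives and under the quantifiers `∀ x ∈ y` and `∃ x ∈ y`. -/
inductive IsDelta0 : FormulaClass
  | falsum (p n : ℕ) : IsDelta0 p n FirstOrder.Language.BoundedFormula.falsum
  | equal (p n : ℕ) (t s : setLang.Term (Fin p ⊕ Fin n)) :
      IsDelta0 p n (FirstOrder.Language.BoundedFormula.equal t s)
  | rel (p n l : ℕ) (R : setLang.Relations l) (ts : Fin l → setLang.Term (Fin p ⊕ Fin n)) :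
      IsDelta0 p n (FirstOrder.Language.BoundedFormula.rel R ts)
  | imp (p n : ℕ) (φ ψ : setLang.BoundedFormula (Fin p) n) :
      IsDelta0 p n φ → IsDelta0 p n ψ → IsDelta0 p n (φ.imp ψ)
  | ball (p n : ℕ) (y : Fin p ⊕ Fin n) (φ : setLang.BoundedFormula (Fin p) (n + 1)) :
      IsDelta0 p (n + 1) φ → IsDelta0 p n ((memBound y).imp φ).all
  | bex (p n : ℕ) (y : Fin p ⊕ Fin n) (φ : setLang.BoundedFormula (Fin p) (n + 1)) :
      IsDelta0 p (n + 1) φ → IsDelta0 p n (memBound y ⊓ φ).ex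

/-- `Π₁` formulae: a block of universal quantifiers in front of a `Δ₀` formula. -/
inductive IsPi1 : FormulaClass
  | of_delta0 (p n : ℕ) (φ : setLang.BoundedFormula (Fin p) n) : IsDelta0 p n φ → IsPi1 p n φ
  | all (p n : ℕ) (φ : setLang.BoundedFormula (Fin p) (n + 1)) :
      IsPi1 p (n + 1) φ → IsPi1 p n φ.all

/-- `Π_∞`: all formulae. -/
def AllFormulae : FormulaClass := fun _ _ _ => True

/-! ### Axiom schemes, as statements about a structure -/

/-- `M ⊨ Γ-Separation`. -/
def Separation (Γ : FormulaClass) (M : Type*) [setLang.Structure M] : Prop :=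
  ∀ (p : ℕ) (φ : setLang.BoundedFormula (Fin p) 1), Γ p 1 φ →
    ∀ (z : Fin p → M) (w : M), ∃ y : M, ∀ x : M, x ∈ᴹ y ↔ x ∈ᴹ w ∧ φ.Realize z ![x]

/-- `M ⊨ Γ-Collection`. -/
def Collection (Γ : FormulaClass) (M : Type*) [setLang.Structure M] : Prop :=
  ∀ (p : ℕ) (φ : setLang.BoundedFormula (Fin p) 2), Γ p 2 φ →
    ∀ (z : Fin p → M) (w : M),
      (∀ x : M, x ∈ᴹ w → ∃ y : M, φ.Realize z ![x, y]) →
        ∃ c : M, ∀ x : M, x ∈ᴹ w → ∃ y : M, y ∈ᴹ c ∧ φ.Realize z ![x, y]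

/-- `M ⊨ Γ-Foundation`. -/
def Foundation (Γ : FormulaClass) (M : Type*) [setLang.Structure M] : Prop :=
  ∀ (p : ℕ) (φ : setLang.BoundedFormula (Fin p) 1), Γ p 1 φ →
    ∀ z : Fin p → M, (∃ x : M, φ.Realize z ![x]) →
      ∃ y : M, φ.Realize z ![y] ∧ ∀ x : M, x ∈ᴹ y → ¬ φ.Realize z ![x]

/-! ### Set-theoretic notions, interpreted in a structure `M` -/

section Internal

variable {M : Type*} [setLang.Structure M]

/-- `M ⊨ x ⊆ y`. -/
def Subset (x y : M) : Prop := ∀ z : M, z ∈ᴹ x → z ∈ᴹ y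

/-- `M ⊨ ⋃ x ⊆ x`, i.e. `x` is transitive. -/
def IsTransitive (x : M) : Prop := ∀ y z : M, y ∈ᴹ x → z ∈ᴹ y → z ∈ᴹ x

/-- `M ⊨ p = {a, b}`. -/
def IsUPair (p a b : M) : Prop := ∀ z : M, z ∈ᴹ p ↔ z = a ∨ z = b

/-- `M ⊨ p = ⟨a, b⟩`, where `⟨a, b⟩ = {{a}, {a, b}}`. -/
def IsOPair (p a b : M) : Prop := ∃ u v : M, IsUPair u a a ∧ IsUPair v a b ∧ IsUPair p u v

/-- `M ⊨ ⟨a, b⟩ ∈ r`. -/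
def PairMem (a b r : M) : Prop := ∃ p : M, IsOPair p a b ∧ p ∈ᴹ r

/-- `M ⊨ α is an ordinal`, i.e. a transitive set of transitive sets. -/
def IsOrdinal (α : M) : Prop := IsTransitive α ∧ ∀ β : M, β ∈ᴹ α → IsTransitive β

/-- `M ⊨ f is a function`. -/
def IsFunction (f : M) : Prop :=
  (∀ p : M, p ∈ᴹ f → ∃ x y : M, IsOPair p x y) ∧
    ∀ x y y' : M, PairMem x y f → PairMem x y' f → y = y'

/-- `M ⊨ dom(f) = a`. -/
def HasDomain (f a : M) : Prop := ∀ x : M, x ∈ᴹ a ↔ ∃ y : M, PairMem x y f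

/-- `M ⊨ g = f ↾ b`. -/
def IsRestriction (g f b : M) : Prop :=
  ∀ p : M, p ∈ᴹ g ↔ p ∈ᴹ f ∧ ∃ x y : M, x ∈ᴹ b ∧ IsOPair p x y

/-- `M ⊨ f is an injective function from a into b`. -/
def IsInjectionInto (f a b : M) : Prop :=
  IsFunction f ∧ HasDomain f a ∧ (∀ x y : M, PairMem x y f → y ∈ᴹ b) ∧
    ∀ x x' y : M, PairMem x y f → PairMem x' y f → x = x'

/-- `M ⊨ |a| ≤ |b|`. -/
def CardLE (a b : M) : Prop := ∃ f : M, IsInjectionInto f a b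

/-- `M ⊨ |a| < |b|`. -/
def CardLT (a b : M) : Prop := CardLE a b ∧ ¬ CardLE b a

/-- `M ⊨ r is a (strict) well-ordering of x`. -/
def IsWellOrderingOf (r x : M) : Prop :=
  (∀ p : M, p ∈ᴹ r → ∃ a b : M, a ∈ᴹ x ∧ b ∈ᴹ x ∧ IsOPair p a b) ∧
  (∀ a : M, ¬ PairMem a a r) ∧
  (∀ a b c : M, PairMem a b r → PairMem b c r → PairMem a c r) ∧
  (∀ a b : M, a ∈ᴹ x → b ∈ᴹ x → PairMem a b r ∨ a = b ∨ PairMem b a r) ∧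
  ∀ s : M, Subset s x → (∃ a : M, a ∈ᴹ s) →
    ∃ a : M, a ∈ᴹ s ∧ ∀ b : M, b ∈ᴹ s → ¬ PairMem b a r

end Internal

/-! ### Theories -/

/-- `M ⊨ 𝐌⁻`. -/
structure ModelsMMinus (M : Type*) [setLang.Structure M] : Prop where
  extensionality : ∀ x y : M, (∀ z : M, z ∈ᴹ x ↔ z ∈ᴹ y) → x = y
  emptyset : ∃ e : M, ∀ z : M, ¬ z ∈ᴹ e
  pair : ∀ a b : M, ∃ p : M, IsUPair p a b
  union : ∀ x : M, ∃ u : M, ∀ z : M, z ∈ᴹ u ↔ ∃ y : M, y ∈ᴹ x ∧ z ∈ᴹ y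
  infinity : ∃ w : M, (∃ e : M, e ∈ᴹ w ∧ ∀ z : M, ¬ z ∈ᴹ e) ∧
    ∀ x : M, x ∈ᴹ w → ∃ y : M, y ∈ᴹ w ∧ ∀ z : M, z ∈ᴹ y ↔ z ∈ᴹ x ∨ z = x
  transitive_containment : ∀ x : M, ∃ y : M, IsTransitive y ∧ Subset x y
  delta0_separation : Separation IsDelta0 M
  set_foundation : ∀ z : M, (∃ x : M, x ∈ᴹ z) →
    ∃ y : M, y ∈ᴹ z ∧ ∀ x : M, x ∈ᴹ y → ¬ x ∈ᴹ z

/-- `M ⊨ KPI`. -/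
structure ModelsKPI (M : Type*) [setLang.Structure M] : Prop extends ModelsMMinus M where
  delta0_collection : Collection IsDelta0 M
  pi1_foundation : Foundation IsPi1 M

/-- `M ⊨ ZF⁻`. -/
structure ModelsZFMinus (M : Type*) [setLang.Structure M] : Prop extends ModelsKPI M where
  collection : Collection AllFormulae M

/-- `M ⊨ WO`: every set can be well-ordered. -/
def ModelsWO (M : Type*) [setLang.Structure M] : Prop :=
  ∀ x : M, ∃ r : M, IsWellOrderingOf r x

/-- `M ⊨ Π¹_∞-DC_α`, for an element `α` of `M`. -/
def DependentChoice (M : Type*) [setLang.Structure M] (α : M) : Prop :=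
  ∀ (p : ℕ) (φ : setLang.BoundedFormula (Fin p) 2) (z : Fin p → M),
    (∀ g γ : M, γ ∈ᴹ α → IsFunction g → HasDomain g γ → ∃ y : M, φ.Realize z ![g, y]) →
      ∃ f : M, IsFunction f ∧ HasDomain f α ∧
        ∀ β : M, β ∈ᴹ α →
          ∃ g y : M, IsRestriction g f β ∧ PairMem β y f ∧ φ.Realize z ![g, y]

/-- `M ⊨ ∀ α Π¹_∞-DC_α`, where `α` ranges over the ordinals of `M`. -/
def ModelsDC (M : Type*) [setLang.Structure M] : Prop :=
  ∀ α : M, IsOrdinal α → DependentChoice M α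

/-! ### The well-founded part -/

/-- The underlying set of the well-founded part of `M`: the elements of `M` from which no
infinite `∈ᴹ`-descending sequence starts. -/
def WF (M : Type*) [setLang.Structure M] : Set M :=
  {x | ¬ ∃ f : ℕ → M, f 0 = x ∧ ∀ n : ℕ, f (n + 1) ∈ᴹ f n}

/-- The set `a* = {x ∈ M | M ⊨ x ∈ a}`. -/
def ext {M : Type*} [setLang.Structure M] (a : M) : Set M := {x | x ∈ᴹ a}

/-- The well-founded part of `M` is c-bounded in `M`. -/
def WFCBounded (M : Type*) [setLang.Structure M] : Prop :=
  ∃ x : M, ∀ w ∈ WF M, CardLT w x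

/-- The well-founded part of `M` is contained. -/
def WFContained (M : Type*) [setLang.Structure M] : Prop :=
  ∃ c : M, WF M ⊆ ext c

end SetModel

/-! Suppose the well-founded part is not contained. Say that `y` has rank at most that of `a` when
some set-sized simulation of membership in itself relates `y` to `a`; this is definable without a
rank function. If `a` is ill-founded, every well-founded set has rank at most that of `a`
(`rankLE_of_mem_WF`), so the class `{y | RankLE y a}` lies in no set. The bounding set `x` is such
an `a`, since `|x| < |x|` is absurd. The property "this class lies in no set" is definable, so some
`a` is ∈-minimal with it. Its members lack the property, hence are well-founded, and so `a` is
well-founded.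

Everything of rank at most that of a well-founded set is well-founded (`mem_WF_of_rankLE`), so a
proper class sits inside the well-founded part. Dependent choice gives it a subset `s` with `|x| ≤
|s|` (`exists_cardLE_subset`). A set of well-founded sets is well-founded, so `|s| < |x|`: a
contradiction.

The remaining work is internal to the model: full separation and foundation for definable classes,
and collapsing a well-ordering of `x` to an ordinal along which to choose. -/

namespace SetModel

open FirstOrder FirstOrder.Language

universe u

/-! ### Definability with parameters, by instance search -/

section Definability

variable {M : Type u} [setLang.Structure M]

/-- `P` is definable over `M` by a formula with parameters in `M`. -/
class Def {n : ℕ} (P : (Fin n → M) → Prop) : Prop where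
  out : ∃ φ : setLang.BoundedFormula M n, ∀ v, φ.Realize id v ↔ P v

/-- `t` is a coordinate projection or a constant. -/
class Tm {n : ℕ} (t : (Fin n → M) → M) : Prop where
  out : ∃ s : M ⊕ Fin n, ∀ v, t v = Sum.elim id v s

instance Tm.const {n : ℕ} (c : M) : Tm (fun _ : Fin n → M => c) := ⟨.inl c, fun _ => rfl⟩

instance Tm.proj {n : ℕ} (i : Fin n) : Tm (fun v : Fin n → M => v i) := ⟨.inr i, fun _ => rfl⟩

theorem realize_term {α : Type*} (t : setLang.Term α) :
    ∃ a, ∀ v : α → M, t.realize v = v a := by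
  cases t with
  | var a => exact ⟨a, fun _ => rfl⟩
  | func f _ => exact f.elim

instance Def.imp {n : ℕ} (P Q : (Fin n → M) → Prop) [hP : Def P] [hQ : Def Q] :
    Def (fun v => P v → Q v) := by
  obtain ⟨φ, hφ⟩ := hP.out
  obtain ⟨ψ, hψ⟩ := hQ.out
  exact ⟨φ.imp ψ, fun v => by rw [BoundedFormula.realize_imp, hφ, hψ]⟩

instance Def.false {n : ℕ} : Def (fun _ : Fin n → M => False) := ⟨.falsum, fun _ => Iff.rfl⟩

theorem Def.congr {n : ℕ} {P Q : (Fin n → M) → Prop} (hP : Def P) (h : ∀ v, P v ↔ Q v) :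
    Def Q := by
  rwa [← funext fun v => propext (h v)]

instance Def.not {n : ℕ} (P : (Fin n → M) → Prop) [Def P] : Def (fun v => ¬ P v) :=
  Def.imp P (fun _ => False)

instance Def.and {n : ℕ} (P Q : (Fin n → M) → Prop) [Def P] [Def Q] :
    Def (fun v => P v ∧ Q v) :=
  (inferInstance : Def fun v => ¬ (P v → ¬ Q v)).congr fun v => by tauto

instance Def.or {n : ℕ} (P Q : (Fin n → M) → Prop) [Def P] [Def Q] :
    Def (fun v => P v ∨ Q v) :=
  (inferInstance : Def fun v => ¬ P v → Q v).congr fun v => by tauto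

instance Def.iff {n : ℕ} (P Q : (Fin n → M) → Prop) [Def P] [Def Q] :
    Def (fun v => P v ↔ Q v) :=
  (inferInstance : Def fun v => (P v → Q v) ∧ (Q v → P v)).congr fun v => by tauto

instance Def.all {n : ℕ} (P : (Fin n → M) → M → Prop)
    [h : Def (fun w : Fin (n + 1) → M => P (fun i => w i.castSucc) (w (Fin.last n)))] :
    Def (fun v => ∀ y, P v y) := by
  obtain ⟨φ, hφ⟩ := h.out
  refine ⟨φ.all, fun v => ?_⟩
  simp [BoundedFormula.realize_all, hφ]

instance Def.ex {n : ℕ} (P : (Fin n → M) → M → Prop)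
    [Def (fun w : Fin (n + 1) → M => P (fun i => w i.castSucc) (w (Fin.last n)))] :
    Def (fun v => ∃ y, P v y) :=
  (inferInstance : Def fun v => ¬ ∀ y, ¬ P v y).congr fun v => by simp

instance Def.eq {n : ℕ} (s t : (Fin n → M) → M) [hs : Tm s] [ht : Tm t] :
    Def (fun v => s v = t v) := by
  obtain ⟨a, ha⟩ := hs.out
  obtain ⟨b, hb⟩ := ht.out
  exact ⟨.equal (.var a) (.var b), fun v => by rw [ha, hb]; exact Iff.rfl⟩

instance Def.mem {n : ℕ} (s t : (Fin n → M) → M) [hs : Tm s] [ht : Tm t] :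
    Def (fun v => s v ∈ᴹ t v) := by
  obtain ⟨a, ha⟩ := hs.out
  obtain ⟨b, hb⟩ := ht.out
  refine ⟨.rel memSymb ![.var a, .var b], fun v => ?_⟩
  rw [ha, hb, Mem]
  simp only [BoundedFormula.Realize]
  congr! 2 with i
  fin_cases i <;> rfl

/-- Needed to reuse a definable predicate with other variables or constants as arguments. Under a
quantifier, `t` is extended to fix the newly bound variable. -/
theorem exists_substitution {k : ℕ} (φ : setLang.BoundedFormula M k) :
    ∀ (n : ℕ) (t : Fin k → M ⊕ Fin n), ∃ ψ : setLang.BoundedFormula M n,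
      ∀ v, ψ.Realize id v ↔ φ.Realize id (fun i => Sum.elim id v (t i)) := by
  induction φ with
  | falsum => exact fun n t => ⟨.falsum, fun _ => Iff.rfl⟩
  | equal s s' =>
    intro n t
    obtain ⟨a, ha⟩ := realize_term (M := M) s
    obtain ⟨b, hb⟩ := realize_term (M := M) s'
    refine ⟨.equal (.var (Sum.elim .inl t a)) (.var (Sum.elim .inl t b)), fun v => ?_⟩
    simp only [BoundedFormula.Realize, ha, hb, Term.realize]
    rcases a with a | a <;> rcases b with b | b <;> rfl
  | rel R ts =>
    intro n t
    choose a ha using fun i => realize_term (M := M) (ts i)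
    refine ⟨.rel R fun i => .var (Sum.elim .inl t (a i)), fun v => ?_⟩
    simp only [BoundedFormula.Realize, ha, Term.realize]
    congr! 2 with i
    rcases a i with a | a <;> rfl
  | imp φ ψ hφ hψ =>
    intro n t
    obtain ⟨φ', h⟩ := hφ n t
    obtain ⟨ψ', h'⟩ := hψ n t
    exact ⟨φ'.imp ψ', fun v => by simp only [BoundedFormula.realize_imp, h, h']⟩
  | @all k φ hφ =>
    intro n t
    obtain ⟨ψ, h⟩ := hφ (n + 1)
      (Fin.snoc (fun i => Sum.map id Fin.castSucc (t i)) (.inr (Fin.last n)))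
    refine ⟨ψ.all, fun v => ?_⟩
    simp only [BoundedFormula.realize_all, h]
    refine forall_congr' fun a => ?_
    congr! 1
    funext i
    induction i using Fin.lastCases with
    | last => simp
    | cast i => rcases h : t i with c | c <;> simp [h]

theorem Def.comp {k n : ℕ} {P : (Fin k → M) → Prop} (hP : Def P) (t : Fin k → (Fin n → M) → M)
    (ht : ∀ i, Tm (t i)) : Def (fun w => P (fun i => t i w)) := by
  obtain ⟨φ, hφ⟩ := hP.out
  choose s hs using fun i => (ht i).out
  obtain ⟨ψ, hψ⟩ := exists_substitution φ n s
  exact ⟨ψ, fun v => by rw [hψ, hφ]; simp only [hs]⟩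

theorem Def.comp₁ {R : M → Prop} (h : Def fun v : Fin 1 → M => R (v 0)) {n : ℕ}
    (a : (Fin n → M) → M) [ha : Tm a] : Def (fun w => R (a w)) :=
  h.comp ![a] (by intro i; fin_cases i; exact ha)

theorem Def.comp₂ {R : M → M → Prop} (h : Def fun v : Fin 2 → M => R (v 0) (v 1)) {n : ℕ}
    (a b : (Fin n → M) → M) [ha : Tm a] [hb : Tm b] : Def (fun w => R (a w) (b w)) :=
  h.comp ![a, b] (by intro i; fin_cases i; exacts [ha, hb])

theorem Def.comp₃ {R : M → M → M → Prop} (h : Def fun v : Fin 3 → M => R (v 0) (v 1) (v 2))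
    {n : ℕ} (a b c : (Fin n → M) → M) [ha : Tm a] [hb : Tm b] [hc : Tm c] :
    Def (fun w => R (a w) (b w) (c w)) :=
  h.comp ![a, b, c] (by intro i; fin_cases i; exacts [ha, hb, hc])

instance Def.isUPair {n : ℕ} (a b c : (Fin n → M) → M) [Tm a] [Tm b] [Tm c] :
    Def (fun w => IsUPair (a w) (b w) (c w)) :=
  Def.comp₃ (R := IsUPair) (by unfold IsUPair; infer_instance) a b c

instance Def.isOPair {n : ℕ} (a b c : (Fin n → M) → M) [Tm a] [Tm b] [Tm c] :
    Def (fun w => IsOPair (a w) (b w) (c w)) :=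
  Def.comp₃ (R := IsOPair) (by unfold IsOPair; infer_instance) a b c

instance Def.pairMem {n : ℕ} (a b c : (Fin n → M) → M) [Tm a] [Tm b] [Tm c] :
    Def (fun w => PairMem (a w) (b w) (c w)) :=
  Def.comp₃ (R := PairMem) (by unfold PairMem; infer_instance) a b c

/-- A definable predicate is given by a formula with finitely many parameters. -/
theorem Def.exists_formula {n : ℕ} {P : (Fin n → M) → Prop} (hP : Def P) :
    ∃ (p : ℕ) (φ : setLang.BoundedFormula (Fin p) n) (z : Fin p → M),
      ∀ v, φ.Realize z v ↔ P v := by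
  classical
  obtain ⟨φ, hφ⟩ := hP.out
  let e := φ.freeVarFinset.equivFin
  refine ⟨_, φ.restrictFreeVar e, fun i => (e.symm i : M), fun v => ?_⟩
  rw [← hφ, BoundedFormula.realize_restrictFreeVar id]
  simp

theorem Def.of_formula {p n : ℕ} (φ : setLang.BoundedFormula (Fin p) n) (z : Fin p → M) :
    Def (fun v => φ.Realize z v) := by
  refine ⟨φ.subst fun i => .var (z i), fun v => ?_⟩
  rw [BoundedFormula.realize_subst]
  rfl

end Definability

/-! ### Full separation -/

/-- Used to merge the parameter lists of two formulae and to make room for a bounding set as an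
extra parameter. -/
theorem IsDelta0.exists_relabel {p n : ℕ} {φ : setLang.BoundedFormula (Fin p) n}
    (hφ : IsDelta0 p n φ) (M : Type u) [setLang.Structure M] {q : ℕ} (g : Fin p → Fin q) :
    ∃ ψ : setLang.BoundedFormula (Fin q) n, IsDelta0 q n ψ ∧
      ∀ (z : Fin q → M) v, ψ.Realize z v ↔ φ.Realize (z ∘ g) v := by
  induction hφ with
  | falsum => exact ⟨_, .falsum _ _, fun _ _ => Iff.rfl⟩
  | equal p n s s' =>
    obtain ⟨a, ha⟩ := realize_term (M := M) s
    obtain ⟨b, hb⟩ := realize_term (M := M) s'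
    refine ⟨_, .equal _ _ (.var (Sum.map g id a)) (.var (Sum.map g id b)), fun z v => ?_⟩
    simp only [BoundedFormula.Realize, ha, hb, Term.realize]
    rcases a with a | a <;> rcases b with b | b <;> rfl
  | rel p n l R ts =>
    choose a ha using fun i => realize_term (M := M) (ts i)
    refine ⟨_, .rel _ _ _ R fun i => .var (Sum.map g id (a i)), fun z v => ?_⟩
    simp only [BoundedFormula.Realize, ha, Term.realize]
    congr! 2 with i
    rcases a i with a | a <;> rfl
  | imp p n φ ψ _ _ h h' =>
    obtain ⟨φ', h1, h2⟩ := h g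
    obtain ⟨ψ', h1', h2'⟩ := h' g
    exact ⟨_, .imp _ _ _ _ h1 h1', fun z v => by simp only [BoundedFormula.realize_imp, h2, h2']⟩
  | ball p n y φ _ h =>
    obtain ⟨φ', h1, h2⟩ := h g
    refine ⟨_, .ball _ _ (Sum.map g id y) _ h1, fun z v => ?_⟩
    simp only [BoundedFormula.realize_all, BoundedFormula.realize_imp, h2, memBound,
      BoundedFormula.realize_rel₂, Term.realize]
    rcases y with y | y <;> rfl
  | bex p n y φ _ h =>
    obtain ⟨φ', h1, h2⟩ := h g
    refine ⟨_, .bex _ _ (Sum.map g id y) _ h1, fun z v => ?_⟩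
    simp only [BoundedFormula.realize_ex, BoundedFormula.realize_inf, h2, memBound,
      BoundedFormula.realize_rel₂, Term.realize]
    rcases y with y | y <;> rfl

section ZFMinus

variable {M : Type u} [setLang.Structure M]

theorem ModelsZFMinus.coll (hM : ModelsZFMinus M) (P : M → M → Prop)
    (hP : Def fun v : Fin 2 → M => P (v 0) (v 1)) (w : M) (h : ∀ x, x ∈ᴹ w → ∃ y, P x y) :
    ∃ c, ∀ x, x ∈ᴹ w → ∃ y, y ∈ᴹ c ∧ P x y := by
  obtain ⟨p, φ, z, hφ⟩ := hP.exists_formula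
  simpa [hφ] using hM.collection p φ trivial z w (by simpa [hφ] using h)

/-- Collection for witnesses depending on a tuple of elements of `w`. -/
theorem ModelsZFMinus.exists_multi_collection (hM : ModelsZFMinus M) (w : M) :
    ∀ (n : ℕ) (P : (Fin n → M) → M → Prop),
      Def (fun v : Fin (n + 1) → M => P (fun i => v i.castSucc) (v (Fin.last n))) →
      ∃ c, ∀ v : Fin n → M, (∀ i, v i ∈ᴹ w) → (∃ y, P v y) → ∃ y, y ∈ᴹ c ∧ P v y := by
  intro n
  induction n with
  | zero =>
    intro P _
    by_cases h : ∃ y, P Fin.elim0 y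
    · obtain ⟨y, hy⟩ := h
      obtain ⟨c, hc⟩ := hM.pair y y
      refine ⟨c, fun v _ _ => ⟨y, (hc y).2 (.inl rfl), ?_⟩⟩
      rwa [Subsingleton.elim v Fin.elim0]
    · refine ⟨w, fun v _ hv => (h ?_).elim⟩
      rwa [Subsingleton.elim v Fin.elim0] at hv
  | succ n ih =>
    intro P hP
    have hP' : Def fun v : Fin (n + 2) → M => P (Fin.snoc (fun i => v i.castSucc.castSucc)
        (v (Fin.last n).castSucc)) (v (Fin.last (n + 1))) :=
      hP.congr fun v => by
        congr! 1
        funext i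
        induction i using Fin.lastCases <;> simp
    -- For fixed `v`, Collection over the last coordinate gives a set of witnesses. The induction
    -- hypothesis collects these sets into `d`, and the union of `d` works.
    obtain ⟨d, hd⟩ := ih (fun v c => ∀ x, x ∈ᴹ w → (∃ y, P (Fin.snoc v x) y) →
      ∃ y, y ∈ᴹ c ∧ P (Fin.snoc v x) y) <| by
        have h1 : Def fun v : Fin (n + 3) → M => P (Fin.snoc
            (fun i => v i.castSucc.castSucc.castSucc)
            (v (Fin.last (n + 1)).castSucc)) (v (Fin.last (n + 2))) := by
          refine (hP'.comp (Fin.snoc (Fin.snoc (fun i v => v i.castSucc.castSucc.castSucc)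
            (fun v => v (Fin.last (n + 1)).castSucc)) (fun v => v (Fin.last (n + 2)))) ?_).congr ?_
          · intro i
            induction i using Fin.lastCases with
            | last => simpa using Tm.proj _
            | cast i =>
              induction i using Fin.lastCases with
              | last => simpa using Tm.proj _
              | cast i => simpa using Tm.proj _
          · intro v
            simp
        infer_instance
    obtain ⟨c, hc⟩ := hM.union d
    refine ⟨c, fun v hv hy => ?_⟩
    have hQ : Def fun u : Fin 2 → M => (∃ y, P (Fin.snoc (Fin.init v) (u 0)) y) →
        P (Fin.snoc (Fin.init v) (u 0)) (u 1) := by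
      have h1 : ∀ {m : ℕ} (i j : Fin m), Def fun u : Fin m → M =>
          P (Fin.snoc (Fin.init v) (u i)) (u j) := by
        intro m i j
        refine (hP'.comp (Fin.snoc (Fin.snoc (fun i _ => v i.castSucc)
          (fun u => u i)) (fun u => u j)) ?_).congr ?_
        · intro i
          induction i using Fin.lastCases with
          | last => simpa using Tm.proj _
          | cast i =>
            induction i using Fin.lastCases with
            | last => simpa using Tm.proj _
            | cast i => simpa using Tm.const _
        · intro v
          simp [Fin.init_def]
      infer_instance
    obtain ⟨e, he⟩ := hM.coll (fun x y => (∃ y, P (Fin.snoc (Fin.init v) x) y) →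
      P (Fin.snoc (Fin.init v) x) y) hQ w fun x _ => by
        by_cases h : ∃ y, P (Fin.snoc (Fin.init v) x) y
        · exact ⟨h.choose, fun _ => h.choose_spec⟩
        · exact ⟨w, fun h' => (h h').elim⟩
    obtain ⟨e, hed, he⟩ := hd (Fin.init v) (fun i => hv _) ⟨e, fun x hx hy => by
      obtain ⟨y, hy', h⟩ := he x hx
      exact ⟨y, hy', h hy⟩⟩
    rw [← Fin.snoc_init_self v] at hy ⊢
    obtain ⟨y, hy, h⟩ := he _ (hv _) hy
    exact ⟨y, (hc y).2 ⟨e, hed, hy⟩, h⟩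

theorem ModelsMMinus.exists_union₂ (hM : ModelsMMinus M) (a b : M) :
    ∃ c, ∀ x, x ∈ᴹ c ↔ x ∈ᴹ a ∨ x ∈ᴹ b := by
  obtain ⟨p, hp⟩ := hM.pair a b
  obtain ⟨c, hc⟩ := hM.union p
  refine ⟨c, fun x => (hc x).trans ⟨?_, ?_⟩⟩
  · rintro ⟨y, hy, h⟩
    obtain rfl | rfl := (hp y).1 hy
    exacts [.inl h, .inr h]
  · rintro (h | h)
    exacts [⟨a, (hp a).2 (.inl rfl), h⟩, ⟨b, (hp b).2 (.inr rfl), h⟩]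

/-- On tuples from a given set, every formula agrees with a `Δ₀` formula. -/
theorem ModelsZFMinus.exists_delta0 (hM : ModelsZFMinus M) {p n : ℕ}
    (φ : setLang.BoundedFormula (Fin p) n) (z : Fin p → M) :
    ∀ w : M, ∃ (q : ℕ) (θ : setLang.BoundedFormula (Fin q) n) (z' : Fin q → M),
      IsDelta0 q n θ ∧ ∀ v, (∀ i, v i ∈ᴹ w) → (θ.Realize z' v ↔ φ.Realize z v) := by
  induction φ with
  | falsum => exact fun w => ⟨_, _, z, .falsum _ _, fun _ _ => Iff.rfl⟩
  | equal s t => exact fun w => ⟨_, _, z, .equal _ _ s t, fun _ _ => Iff.rfl⟩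
  | rel R ts => exact fun w => ⟨_, _, z, .rel _ _ _ R ts, fun _ _ => Iff.rfl⟩
  | imp φ ψ hφ hψ =>
    intro w
    obtain ⟨q, θ, y, h, h'⟩ := hφ w
    obtain ⟨q₁, θ₁, y₁, h₁, h₁'⟩ := hψ w
    obtain ⟨η, k, k'⟩ := h.exists_relabel M (Fin.castAdd q₁)
    obtain ⟨η₁, k₁, k₁'⟩ := h₁.exists_relabel M (Fin.natAdd q)
    refine ⟨q + q₁, _, Fin.append y y₁, .imp _ _ _ _ k k₁, fun v hv => ?_⟩
    have e : Fin.append y y₁ ∘ Fin.castAdd q₁ = y := by funext; simp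
    have e₁ : Fin.append y y₁ ∘ Fin.natAdd q = y₁ := by funext; simp
    rw [BoundedFormula.realize_imp, BoundedFormula.realize_imp, k', k₁', e, e₁, h' v hv,
      h₁' v hv]
  | @all n φ hφ =>
    intro w
    -- `c` contains a counterexample for each tuple from `w` that has one, so the universal
    -- quantifier may be bounded by `c`. The bound variable then lies in `c` rather than `w`, hence
    -- the passage to `w ∪ c`.
    obtain ⟨c, hc⟩ := hM.exists_multi_collection w n
      (fun v y => ¬ φ.Realize z (Fin.snoc v y)) <| by
        have := Def.of_formula φ z
        refine (inferInstance : Def fun v => ¬ φ.Realize z v).congr fun v => ?_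
        congr! 2
        exact (Fin.snoc_init_self v).symm
    obtain ⟨d, hd⟩ := hM.exists_union₂ w c
    obtain ⟨q, θ, y, h, h'⟩ := hφ d
    obtain ⟨η, k, k'⟩ := h.exists_relabel M (Fin.castSucc (n := q))
    refine ⟨q + 1, _, Fin.snoc y c, .ball _ _ (.inl (Fin.last q)) _ k, fun v hv => ?_⟩
    have e : (Fin.snoc y c : Fin (q + 1) → M) ∘ Fin.castSucc = y := by funext; simp
    have key : ∀ a, a ∈ᴹ c → (η.Realize (Fin.snoc y c) (Fin.snoc v a) ↔
        φ.Realize z (Fin.snoc v a)) := by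
      intro a ha
      rw [k', e, h']
      intro i
      induction i using Fin.lastCases with
      | last => simpa using (hd a).2 (.inr ha)
      | cast i => simpa using (hd _).2 (.inl (hv i))
    have hmem : ∀ a, (memBound (n := n) (Sum.inl (Fin.last q))).Realize
        (Fin.snoc y c : Fin (q + 1) → M) (Fin.snoc v a) ↔ a ∈ᴹ c := by
      intro a
      simp [memBound, BoundedFormula.realize_rel₂, Mem]
    simp only [BoundedFormula.realize_all, BoundedFormula.realize_imp, hmem]
    constructor
    · intro H a
      by_contra hn
      obtain ⟨a, ha, hn⟩ := hc v hv ⟨a, hn⟩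
      exact hn ((key a ha).1 (H a ha))
    · exact fun H a ha => (key a ha).2 (H a)

/-- Over `w` the formula may be replaced by a `Δ₀` one, so Collection upgrades `Δ₀`-Separation to
the full scheme. -/
theorem ModelsZFMinus.sep (hM : ModelsZFMinus M) (P : M → Prop)
    (hP : Def fun v : Fin 1 → M => P (v 0)) (w : M) : ∃ y, ∀ x, x ∈ᴹ y ↔ x ∈ᴹ w ∧ P x := by
  obtain ⟨p, φ, z, hφ⟩ := hP.exists_formula
  obtain ⟨q, θ, z', hθ, h⟩ := hM.exists_delta0 φ z w
  obtain ⟨y, hy⟩ := hM.delta0_separation q θ hθ z' w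
  refine ⟨y, fun x => (hy x).trans (and_congr_right fun hx => ?_)⟩
  rw [h _ (by simpa using hx), hφ]
  rfl

/-- Foundation for definable classes. -/
theorem ModelsZFMinus.exists_minimal (hM : ModelsZFMinus M) (P : M → Prop)
    (hP : Def fun v : Fin 1 → M => P (v 0)) (h : ∃ x, P x) :
    ∃ x, P x ∧ ∀ y, y ∈ᴹ x → ¬ P y := by
  obtain ⟨x, hx⟩ := h
  -- Set Foundation applies to the part of the class inside `t`; if that part is empty, `x` itself
  -- is minimal.
  obtain ⟨t, ht, hxt⟩ := hM.transitive_containment x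
  obtain ⟨s, hs⟩ := hM.sep P hP t
  by_cases hne : ∃ y, y ∈ᴹ s
  · obtain ⟨y, hy, hmin⟩ := hM.set_foundation s hne
    obtain ⟨hyt, hPy⟩ := (hs y).1 hy
    exact ⟨y, hPy, fun u hu hPu => hmin u hu ((hs u).2 ⟨ht y u hyt hu, hPu⟩)⟩
  · exact ⟨x, hx, fun y hy hPy => hne ⟨y, (hs y).2 ⟨hxt y hy, hPy⟩⟩⟩

end ZFMinus

/-! ### Ordered pairs and relations -/

section Pairs

variable {M : Type u} [setLang.Structure M]

theorem IsUPair.inj_left {p a b c : M} (h : IsUPair p a b) (h' : IsUPair p a c) : b = c := by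
  have h1 := (h' b).1 ((h b).2 (.inr rfl))
  have h2 := (h c).1 ((h' c).2 (.inr rfl))
  grind

theorem ModelsMMinus.isUPair_unique (hM : ModelsMMinus M) {p q a b : M} (h : IsUPair p a b)
    (h' : IsUPair q a b) : p = q :=
  hM.extensionality _ _ fun z => (h z).trans (h' z).symm

theorem ModelsMMinus.isOPair_unique (hM : ModelsMMinus M) {p q a b : M} (h : IsOPair p a b)
    (h' : IsOPair q a b) : p = q := by
  obtain ⟨u, v, hu, hv, hp⟩ := h
  obtain ⟨u', v', hu', hv', hq⟩ := h'
  obtain rfl := hM.isUPair_unique hu hu'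
  obtain rfl := hM.isUPair_unique hv hv'
  exact hM.isUPair_unique hp hq

theorem ModelsMMinus.exists_isOPair (hM : ModelsMMinus M) (a b : M) : ∃ p, IsOPair p a b := by
  obtain ⟨u, hu⟩ := hM.pair a a
  obtain ⟨v, hv⟩ := hM.pair a b
  obtain ⟨p, hp⟩ := hM.pair u v
  exact ⟨p, u, v, hu, hv, hp⟩

theorem IsOPair.inj {p a b a' b' : M} (h : IsOPair p a b) (h' : IsOPair p a' b') :
    a = a' ∧ b = b' := by
  obtain ⟨u, v, hu, hv, hp⟩ := h
  obtain ⟨u', v', hu', hv', hq⟩ := h'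
  have ha : a = a' := by
    rcases (hq u).1 ((hp u).2 (.inl rfl)) with rfl | rfl
    · simpa using (hu' a).1 ((hu a).2 (.inl rfl))
    · have := (hu a').1 ((hv' a').2 (.inl rfl))
      grind
  subst ha
  refine ⟨rfl, ?_⟩
  have h1 : u = u' ∨ u = v' := (hq u).1 ((hp u).2 (.inl rfl))
  have h2 : v = u' ∨ v = v' := (hq v).1 ((hp v).2 (.inr rfl))
  have h3 : v' = u ∨ v' = v := (hp v').1 ((hq v').2 (.inr rfl))
  rcases h2 with rfl | rfl
  · have hab : b = a := by simpa using (hu' b).1 ((hv b).2 (.inr rfl))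
    rcases h3 with rfl | rfl
    · have := (hu b').1 ((hv' b').2 (.inr rfl))
      grind
    · exact hv.inj_left hv'
  · exact hv.inj_left hv'

theorem ModelsMMinus.pairMem_iff (hM : ModelsMMinus M) {p a b r : M} (h : IsOPair p a b) :
    PairMem a b r ↔ p ∈ᴹ r :=
  ⟨fun ⟨_, hq, hr⟩ => hM.isOPair_unique hq h ▸ hr, fun hr => ⟨p, h, hr⟩⟩

theorem ModelsMMinus.exists_field (hM : ModelsMMinus M) (g : M) :
    ∃ c, ∀ a b, PairMem a b g → a ∈ᴹ c ∧ b ∈ᴹ c := by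
  obtain ⟨d, hd⟩ := hM.union g
  obtain ⟨c, hc⟩ := hM.union d
  refine ⟨c, fun a b => ?_⟩
  rintro ⟨p, ⟨u, v, hu, hv, hp⟩, hg⟩
  have hvd : v ∈ᴹ d := (hd v).2 ⟨p, hg, (hp v).2 (.inr rfl)⟩
  exact ⟨(hc a).2 ⟨v, hvd, (hv a).2 (.inl rfl)⟩, (hc b).2 ⟨v, hvd, (hv b).2 (.inr rfl)⟩⟩

/-- A definable relation restricted to a product of sets is a set. -/
theorem ModelsZFMinus.exists_relation (hM : ModelsZFMinus M) (R : M → M → Prop)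
    (hR : Def fun v : Fin 2 → M => R (v 0) (v 1)) (x y : M) :
    ∃ k, (∀ p, p ∈ᴹ k → ∃ u v, IsOPair p u v) ∧
      ∀ u v, PairMem u v k ↔ u ∈ᴹ x ∧ v ∈ᴹ y ∧ R u v := by
  obtain ⟨w, hw⟩ := hM.exists_union₂ x y
  obtain ⟨c, hc⟩ := hM.exists_multi_collection w 2 (fun v p => IsOPair p (v 0) (v 1))
    inferInstance
  have := hR.comp₂ (n := 3) (fun v => v (Fin.last 1).castSucc) (fun v => v (Fin.last 2))
  obtain ⟨k, hk⟩ := hM.sep (fun p => ∃ u v, IsOPair p u v ∧ u ∈ᴹ x ∧ v ∈ᴹ y ∧ R u v)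
    inferInstance c
  refine ⟨k, fun p hp => ?_, fun u v => ⟨?_, ?_⟩⟩
  · obtain ⟨-, u, v, h, -⟩ := (hk p).1 hp
    exact ⟨u, v, h⟩
  · rintro ⟨p, hp, hpk⟩
    obtain ⟨-, u', v', h, h'⟩ := (hk p).1 hpk
    obtain ⟨rfl, rfl⟩ := hp.inj h
    exact h'
  · rintro ⟨hu, hv, h⟩
    obtain ⟨p, hpc, hp⟩ := hc ![u, v]
      (by intro i; fin_cases i; exacts [(hw u).2 (.inl hu), (hw v).2 (.inr hv)])
      (hM.exists_isOPair u v)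
    exact ⟨p, hp, (hk p).2 ⟨hpc, u, v, hp, hu, hv, h⟩⟩

/-! ### Coinductive definitions by set-sized approximations -/

/-- The union of all set relations `h` that are post-fixed points of `Φ`. -/
def Post (Φ : M → M → M → Prop) (x a : M) : Prop :=
  ∃ h, (∀ x' a', PairMem x' a' h → Φ h x' a') ∧ PairMem x a h

theorem Def.post {Φ : M → M → M → Prop} (hΦ : Def fun v : Fin 3 → M => Φ (v 0) (v 1) (v 2))
    {n : ℕ} (s t : (Fin n → M) → M) [Tm s] [Tm t] : Def fun v => Post Φ (s v) (t v) := by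
  refine Def.comp₂ (R := Post Φ) ?_ s t
  unfold Post
  have := hΦ.comp₃ (n := 5) (fun v => v (Fin.last 2).castSucc.castSucc)
    (fun v => v (Fin.last 3).castSucc) (fun v => v (Fin.last 4))
  infer_instance

theorem Post.exists_step {Φ : M → M → M → Prop} {x a : M} (hx : Post Φ x a) : ∃ h, Φ h x a ∧ ∀ x' a', PairMem x' a' h → Post Φ x' a' := by
  obtain ⟨h, hh, hxa⟩ := hx
  exact ⟨h, hh _ _ hxa, fun x' a' h' => ⟨h, hh, h'⟩⟩

/-- Collect post-fixed witnesses for the pairs in `k`, take their union and add the pair `(x, a)`;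
by monotonicity the result is again post-fixed. -/
theorem ModelsZFMinus.post_of_step (hM : ModelsZFMinus M) {Φ : M → M → M → Prop}
    (hΦ : Def fun v : Fin 3 → M => Φ (v 0) (v 1) (v 2))
    (mono : ∀ h h' x a, (∀ x' a', PairMem x' a' h → PairMem x' a' h') → Φ h x a → Φ h' x a)
    {k x a : M} (hk : ∀ x' a', PairMem x' a' k → Post Φ x' a') (h : Φ k x a) : Post Φ x a := by
  let S : M → Prop := fun h => ∀ x' a', PairMem x' a' h → Φ h x' a'
  have hS : ∀ {n : ℕ} (i : Fin n), Def fun v : Fin n → M => S (v i) := by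
    intro n i
    have := hΦ.comp₃ (n := n + 2) (fun v => v i.castSucc.castSucc)
      (fun v => v (Fin.last n).castSucc) (fun v => v (Fin.last (n + 1)))
    infer_instance
  obtain ⟨c, hc⟩ := hM.coll (fun p h => (∃ x' a', IsOPair p x' a') → S h ∧ p ∈ᴹ h)
    (by have := hS (n := 2) 1; infer_instance) k <| by
      intro p hp
      by_cases hpp : ∃ x' a', IsOPair p x' a'
      · obtain ⟨x', a', hpp⟩ := hpp
        obtain ⟨h, hh, hxa⟩ := hk x' a' ⟨p, hpp, hp⟩
        exact ⟨h, fun _ => ⟨hh, (hM.pairMem_iff hpp).1 hxa⟩⟩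
      · exact ⟨p, fun h' => (hpp h').elim⟩
  -- Collection may put other sets into `c`; only the post-fixed ones may enter the union.
  obtain ⟨d, hd⟩ := hM.sep S (hS 0) c
  obtain ⟨e, he⟩ := hM.union d
  obtain ⟨p, hp⟩ := hM.exists_isOPair x a
  obtain ⟨q, hq⟩ := hM.pair p p
  obtain ⟨u, hu⟩ := hM.exists_union₂ e q
  refine ⟨u, fun x' a' => ?_, p, hp, (hu p).2 (.inr ((hq p).2 (.inl rfl)))⟩
  rintro ⟨p', hp', hpu⟩
  rcases (hu p').1 hpu with hpe | hpq
  · obtain ⟨s, hsd, hps⟩ := (he p').1 hpe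
    refine mono s u _ _ ?_ (((hd s).1 hsd).2 _ _ ⟨p', hp', hps⟩)
    rintro x₁ a₁ ⟨p₁, hp₁, hps₁⟩
    exact ⟨p₁, hp₁, (hu p₁).2 (.inl ((he p₁).2 ⟨s, hsd, hps₁⟩))⟩
  · obtain rfl : p' = p := by simpa using (hq p').1 hpq
    obtain ⟨rfl, rfl⟩ := hp'.inj hp
    refine mono k u _ _ ?_ h
    rintro x₁ a₁ ⟨p₁, hp₁, hpk⟩
    obtain ⟨s, hsc, hs⟩ := hc p₁ hpk
    obtain ⟨hs, hps⟩ := hs ⟨x₁, a₁, hp₁⟩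
    exact ⟨p₁, hp₁, (hu p₁).2 (.inl ((he p₁).2 ⟨s, (hd s).2 ⟨hsc, hs⟩, hps⟩))⟩

end Pairs

/-! ### Comparison of ranks -/

section Rank

variable {M : Type u} [setLang.Structure M]

/-- One step of a simulation of `(M, ∈)` in itself. -/
def SimStep (h x a : M) : Prop := ∀ x', x' ∈ᴹ x → ∃ a', a' ∈ᴹ a ∧ PairMem x' a' h

/-- `M ⊨ rank x ≤ rank a`. -/
def RankLE (x a : M) : Prop := Post SimStep x a

theorem def_simStep : Def fun v : Fin 3 → M => SimStep (v 0) (v 1) (v 2) := by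
  unfold SimStep; infer_instance

instance Def.rankLE {n : ℕ} (s t : (Fin n → M) → M) [Tm s] [Tm t] :
    Def fun v => RankLE (s v) (t v) :=
  Def.post def_simStep s t

theorem SimStep.mono (h h' x a : M) (hh : ∀ x' a', PairMem x' a' h → PairMem x' a' h')
    (H : SimStep h x a) : SimStep h' x a := fun x' hx' => by
  obtain ⟨a', ha', hp⟩ := H x' hx'
  exact ⟨a', ha', hh _ _ hp⟩

theorem ModelsZFMinus.rankLE_iff (hM : ModelsZFMinus M) {x a : M} :
    RankLE x a ↔ ∀ x', x' ∈ᴹ x → ∃ a', a' ∈ᴹ a ∧ RankLE x' a' := by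
  constructor
  · intro h x' hx'
    obtain ⟨r, hr, hr'⟩ := Post.exists_step h
    obtain ⟨a', ha', hp⟩ := hr x' hx'
    exact ⟨a', ha', hr' _ _ hp⟩
  · intro h
    obtain ⟨k, -, hk⟩ := hM.exists_relation RankLE inferInstance x a
    refine hM.post_of_step def_simStep SimStep.mono (k := k)
      (fun x' a' hp => ((hk _ _).1 hp).2.2) fun x' hx' => ?_
    obtain ⟨a', ha', hx'a'⟩ := h x' hx'
    exact ⟨a', ha', (hk _ _).2 ⟨hx', ha', hx'a'⟩⟩

theorem mem_WF_iff_acc {x : M} : x ∈ WF M ↔ Acc (fun a b : M => a ∈ᴹ b) x := by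
  rw [acc_iff_isEmpty_descending_chain, isEmpty_subtype]
  simp [WF]

theorem mem_WF_of_forall {x : M} (h : ∀ y, y ∈ᴹ x → y ∈ WF M) : x ∈ WF M :=
  mem_WF_iff_acc.2 ⟨_, fun y hy => mem_WF_iff_acc.1 (h y hy)⟩

/-- Each step down from `x` is matched by a step down from `a`; the induction takes place in the
metatheory. -/
theorem ModelsZFMinus.mem_WF_of_rankLE (hM : ModelsZFMinus M) {a : M} (ha : a ∈ WF M) :
    ∀ {x : M}, RankLE x a → x ∈ WF M := by
  induction mem_WF_iff_acc.1 ha with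
  | intro a hacc ih =>
    intro x hx
    refine mem_WF_of_forall fun y hy => ?_
    obtain ⟨b, hb, hyb⟩ := hM.rankLE_iff.1 hx y hy
    exact ih b hb (mem_WF_iff_acc.2 (hacc b hb)) hyb

/-- An ill-founded set has an ill-founded member, which can answer any step down from `x`. -/
theorem ModelsZFMinus.rankLE_of_mem_WF (hM : ModelsZFMinus M) {x : M} (hx : x ∈ WF M) :
    ∀ {a : M}, a ∉ WF M → RankLE x a := by
  induction mem_WF_iff_acc.1 hx with
  | intro x hacc ih =>
    intro a ha
    refine hM.rankLE_iff.2 fun y hy => ?_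
    obtain ⟨b, hb, hb'⟩ : ∃ b, b ∈ᴹ a ∧ b ∉ WF M := by
      by_contra! hcon
      exact ha (mem_WF_of_forall hcon)
    exact ⟨b, hb, ih y hy (mem_WF_iff_acc.2 (hacc y hy)) hb'⟩

end Rank

/-! ### The collapse of a well-ordering -/

section Collapse

variable {M : Type u} [setLang.Structure M]

/-- One step of a bisimulation between the relation `r` and membership. -/
def BisimStep (r h u b : M) : Prop :=
  (∀ v, PairMem v u r → ∃ c, c ∈ᴹ b ∧ PairMem v c h) ∧
    ∀ c, c ∈ᴹ b → ∃ v, PairMem v u r ∧ PairMem v c h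

/-- `M ⊨ b` is the value at `u` of the Mostowski collapse of `r`. -/
def CollapsesTo (r u b : M) : Prop := Post (BisimStep r) u b

theorem def_bisimStep (r : M) : Def fun v : Fin 3 → M => BisimStep r (v 0) (v 1) (v 2) := by
  unfold BisimStep; infer_instance

instance Def.collapsesTo {n : ℕ} (r : M) (s t : (Fin n → M) → M) [Tm s] [Tm t] :
    Def fun v => CollapsesTo r (s v) (t v) :=
  Def.post (def_bisimStep r) s t

theorem BisimStep.mono (r h h' u b : M) (hh : ∀ x' a', PairMem x' a' h → PairMem x' a' h')
    (H : BisimStep r h u b) : BisimStep r h' u b := by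
  refine ⟨fun v hv => ?_, fun c hc => ?_⟩
  · obtain ⟨c, hc, hp⟩ := H.1 v hv
    exact ⟨c, hc, hh _ _ hp⟩
  · obtain ⟨v, hv, hp⟩ := H.2 c hc
    exact ⟨v, hv, hh _ _ hp⟩

theorem ModelsZFMinus.collapsesTo_iff (hM : ModelsZFMinus M) {r u b : M} :
    CollapsesTo r u b ↔ (∀ v, PairMem v u r → ∃ c, c ∈ᴹ b ∧ CollapsesTo r v c) ∧
      ∀ c, c ∈ᴹ b → ∃ v, PairMem v u r ∧ CollapsesTo r v c := by
  constructor
  · intro h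
    obtain ⟨s, hs, hs'⟩ := Post.exists_step h
    refine ⟨fun v hv => ?_, fun c hc => ?_⟩
    · obtain ⟨c, hc, hp⟩ := hs.1 v hv
      exact ⟨c, hc, hs' _ _ hp⟩
    · obtain ⟨v, hv, hp⟩ := hs.2 c hc
      exact ⟨v, hv, hs' _ _ hp⟩
  · rintro ⟨h₁, h₂⟩
    obtain ⟨f, hf⟩ := hM.exists_field r
    obtain ⟨k, -, hk⟩ := hM.exists_relation (CollapsesTo r) inferInstance f b
    refine hM.post_of_step (def_bisimStep r) (BisimStep.mono r) (k := k)
      (fun x' a' hp => ((hk _ _).1 hp).2.2) ⟨fun v hv => ?_, fun c hc => ?_⟩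
    · obtain ⟨c, hc, h⟩ := h₁ v hv
      exact ⟨c, hc, (hk _ _).2 ⟨(hf _ _ hv).1, hc, h⟩⟩
    · obtain ⟨v, hv, h⟩ := h₂ c hc
      exact ⟨v, hv, (hk _ _).2 ⟨(hf _ _ hv).1, hc, h⟩⟩

/-- Take an ∈-minimal value with a competitor. Its members have none, so extensionality identifies
the two values. Foundation is applied to values, so `r` can be arbitrary. -/
theorem ModelsZFMinus.collapsesTo_unique (hM : ModelsZFMinus M) {r u b b' : M}
    (h : CollapsesTo r u b) (h' : CollapsesTo r u b') : b = b' := by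
  by_contra hne
  obtain ⟨b, ⟨u, b', h, h', hne⟩, hmin⟩ := hM.exists_minimal
    (fun b => ∃ u b', CollapsesTo r u b ∧ CollapsesTo r u b' ∧ b ≠ b')
    inferInstance ⟨b, u, b', h, h', hne⟩
  refine hne (hM.extensionality _ _ fun c => ?_)
  have key : ∀ v c c', c ∈ᴹ b → CollapsesTo r v c → CollapsesTo r v c' → c = c' := by
    intro v c c' hc h h'
    by_contra hn
    exact hmin c hc ⟨v, c', h, h', hn⟩
  rw [hM.collapsesTo_iff] at h h'
  constructor
  · intro hc
    obtain ⟨v, hv, hvc⟩ := h.2 c hc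
    obtain ⟨c', hc', hvc'⟩ := h'.1 v hv
    rwa [key v c c' hc hvc hvc']
  · intro hc
    obtain ⟨v, hv, hvc⟩ := h'.2 c hc
    obtain ⟨c', hc', hvc'⟩ := h.1 v hv
    rwa [← key v c' c hc' hvc' hvc]

/-- At an `r`-least point without a value, the values of its predecessors form a set, which would be
its value. -/
theorem ModelsZFMinus.exists_collapsesTo (hM : ModelsZFMinus M) {r x : M}
    (hr : IsWellOrderingOf r x) : ∀ u, u ∈ᴹ x → ∃ b, CollapsesTo r u b := by
  by_contra! hcon
  obtain ⟨u, hux, hu⟩ := hcon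
  obtain ⟨s, hs⟩ := hM.sep (fun u => ¬ ∃ b, CollapsesTo r u b) inferInstance x
  obtain ⟨u, hus, hmin⟩ := hr.2.2.2.2 s (fun z hz => ((hs z).1 hz).1)
    ⟨u, (hs u).2 ⟨hux, by simpa using hu⟩⟩
  have hmem : ∀ {v}, PairMem v u r → v ∈ᴹ x := by
    rintro v ⟨p, hp, hpr⟩
    obtain ⟨a, b, ha, -, hab⟩ := hr.1 p hpr
    rwa [(hp.inj hab).1]
  have hex : ∀ v, PairMem v u r → ∃ b, CollapsesTo r v b := by
    intro v hv
    by_contra hn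
    exact hmin v ((hs v).2 ⟨hmem hv, hn⟩) hv
  obtain ⟨c, hc⟩ := hM.coll (fun v b => PairMem v u r → CollapsesTo r v b) inferInstance x <| by
    intro v _
    by_cases hv : PairMem v u r
    · exact (hex v hv).imp fun b hb _ => hb
    · exact ⟨v, fun h => (hv h).elim⟩
  obtain ⟨b, hb⟩ := hM.sep (fun b => ∃ v, PairMem v u r ∧ CollapsesTo r v b) inferInstance c
  refine ((hs u).1 hus).2 ⟨b, hM.collapsesTo_iff.2 ⟨fun v hv => ?_, fun d hd => ((hb d).1 hd).2⟩⟩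
  obtain ⟨d, hdc, hd⟩ := hc v (hmem hv)
  exact ⟨d, (hb d).2 ⟨hdc, v, hv, hd hv⟩, hd hv⟩

/-- The range of the collapse of a well-ordering is an ordinal. -/
theorem ModelsZFMinus.exists_order_type (hM : ModelsZFMinus M) {r x : M}
    (hr : IsWellOrderingOf r x) :
    ∃ α, IsOrdinal α ∧ ∀ b, b ∈ᴹ α ↔ ∃ u, u ∈ᴹ x ∧ CollapsesTo r u b := by
  obtain ⟨c, hc⟩ := hM.coll (CollapsesTo r) inferInstance x (hM.exists_collapsesTo hr)
  obtain ⟨α, hα⟩ := hM.sep (fun b => ∃ u, u ∈ᴹ x ∧ CollapsesTo r u b) inferInstance c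
  have hα' : ∀ b, b ∈ᴹ α ↔ ∃ u, u ∈ᴹ x ∧ CollapsesTo r u b := by
    refine fun b => (hα b).trans ⟨fun h => h.2, fun ⟨u, hu, h⟩ => ⟨?_, u, hu, h⟩⟩
    obtain ⟨b', hb', h'⟩ := hc u hu
    rwa [hM.collapsesTo_unique h h']
  refine ⟨α, ⟨fun b d hb hd => ?_, fun b hb d e hd he => ?_⟩, hα'⟩
  · obtain ⟨u, hu, h⟩ := (hα' b).1 hb
    obtain ⟨v, ⟨p, hp, hpr⟩, hvd⟩ := (hM.collapsesTo_iff.1 h).2 d hd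
    obtain ⟨a, b, ha, -, hab⟩ := hr.1 p hpr
    exact (hα' d).2 ⟨v, (hp.inj hab).1 ▸ ha, hvd⟩
  · obtain ⟨u, hu, h⟩ := (hα' b).1 hb
    obtain ⟨v, hv, hvd⟩ := (hM.collapsesTo_iff.1 h).2 d hd
    obtain ⟨w, hw, hwe⟩ := (hM.collapsesTo_iff.1 hvd).2 e he
    obtain ⟨e', he', hwe'⟩ := (hM.collapsesTo_iff.1 h).1 w (hr.2.2.1 _ _ _ hw hv)
    rwa [hM.collapsesTo_unique hwe hwe']

end Collapse

/-! ### Subsets of proper classes -/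

section ProperClasses

variable {M : Type u} [setLang.Structure M]

/-- A definable class that is not contained in a set has subsets of every cardinality. -/
theorem ModelsZFMinus.exists_cardLE_subset (hM : ModelsZFMinus M) (hWO : ModelsWO M)
    (hDC : ModelsDC M) (C : M → Prop) (hC : Def fun v : Fin 1 → M => C (v 0))
    (hproper : ¬ ∃ c, ∀ y, C y → y ∈ᴹ c) (x : M) :
    ∃ s, (∀ y, y ∈ᴹ s → C y) ∧ CardLE x s := by
  obtain ⟨r, hr⟩ := hWO x
  obtain ⟨α, hα, hmem⟩ := hM.exists_order_type hr
  -- Choose a member of `C` outside the range of the function built so far. It exists because that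
  -- range lies in a set and `C` does not.
  have hφ : Def fun v : Fin 2 → M => C (v 1) ∧ ∀ β, ¬ PairMem β (v 1) (v 0) := by
    have := hC.comp₁ (n := 2) (fun v => v 1)
    infer_instance
  obtain ⟨p, φ, z, hφ⟩ := hφ.exists_formula
  obtain ⟨f, hf, hdom, hval⟩ := hDC α hα p φ z fun g γ _ _ _ => by
    obtain ⟨c, hc⟩ := hM.exists_field g
    by_contra! hcon
    refine hproper ⟨c, fun y hy => ?_⟩
    by_contra hyc
    exact hcon y ((hφ _).2 ⟨hy, fun β hβ => hyc (hc β y hβ).2⟩)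
  obtain ⟨t, ht⟩ := hM.exists_field f
  obtain ⟨s, hs⟩ := hM.sep (fun y => ∃ β, PairMem β y f) inferInstance t
  have hfresh : ∀ β y, PairMem β y f → C y ∧ ∀ γ, γ ∈ᴹ β → ¬ PairMem γ y f := by
    intro β y hy
    obtain ⟨g, y', hg, hy', h⟩ := hval β ((hdom β).2 ⟨y, hy⟩)
    obtain rfl := hf.2 _ _ _ hy hy'
    obtain ⟨h, h'⟩ := (hφ _).1 h
    refine ⟨h, fun γ hγ ⟨q, hq, hqf⟩ => h' γ ⟨q, hq, (hg q).2 ⟨hqf, γ, y, hγ, hq⟩⟩⟩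
  -- The injection of `x` into `s` is the collapse followed by `f`.
  obtain ⟨k, hk, hk'⟩ := hM.exists_relation (fun u y => ∃ b, CollapsesTo r u b ∧ PairMem b y f)
    inferInstance x s
  refine ⟨s, fun y hy => ?_, k, ⟨hk, fun u y y' h h' => ?_⟩, fun u => ⟨fun hu => ?_, ?_⟩,
    fun u y h => ((hk' _ _).1 h).2.1, fun u v y h h' => ?_⟩
  · obtain ⟨-, β, hβ⟩ := (hs y).1 hy
    exact (hfresh β y hβ).1
  · obtain ⟨-, -, b, hb, hy⟩ := (hk' _ _).1 h
    obtain ⟨-, -, b', hb', hy'⟩ := (hk' _ _).1 h'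
    obtain rfl := hM.collapsesTo_unique hb hb'
    exact hf.2 _ _ _ hy hy'
  · obtain ⟨b, hb⟩ := hM.exists_collapsesTo hr u hu
    obtain ⟨y, hy⟩ := (hdom b).1 ((hmem b).2 ⟨u, hu, hb⟩)
    exact ⟨y, (hk' _ _).2 ⟨hu, (hs y).2 ⟨(ht _ _ hy).2, b, hy⟩, b, hb, hy⟩⟩
  · rintro ⟨y, hy⟩
    exact ((hk' _ _).1 hy).1
  · obtain ⟨hu, -, b, hb, hy⟩ := (hk' _ _).1 h
    obtain ⟨hv, -, b', hb', hy'⟩ := (hk' _ _).1 h'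
    -- If `u` precedes `v`, then `b ∈ b'`, and the value at `b'` was chosen to differ from that at
    -- `b`.
    have key : ∀ {u v b b'}, CollapsesTo r u b → CollapsesTo r v b' → PairMem b y f →
        PairMem b' y f → ¬ PairMem u v r := by
      intro u v b b' hb hb' hy hy' huv
      obtain ⟨c, hc, huc⟩ := (hM.collapsesTo_iff.1 hb').1 u huv
      obtain rfl := hM.collapsesTo_unique hb huc
      exact (hfresh _ _ hy').2 _ hc hy
    rcases hr.2.2.2.1 u v hu hv with h | h | h
    exacts [(key hb hb' hy hy' h).elim, h, (key hb' hb hy' hy h).elim]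

end ProperClasses

end SetModel

/-! ### Containment of the well-founded part -/

theorem mainTheorem10 (M : Type*) [SetModel.setLang.Structure M]
    (hZF : SetModel.ModelsZFMinus M) (hWO : SetModel.ModelsWO M) (hDC : SetModel.ModelsDC M)
    (hbdd : SetModel.WFCBounded M) : SetModel.WFContained M := by
  obtain ⟨x, hx⟩ := hbdd
  have hxWF : x ∉ SetModel.WF M := fun h => (hx x h).2 (hx x h).1
  by_contra hcon
  have hproper : ∀ a : M, a ∉ SetModel.WF M →
      ¬ ∃ c, ∀ y, SetModel.RankLE y a → SetModel.Mem y c := fun a ha ⟨c, hc⟩ =>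
    hcon ⟨c, fun w hw => hc w (hZF.rankLE_of_mem_WF hw ha)⟩
  obtain ⟨a, ha, hmin⟩ := hZF.exists_minimal
    (fun a => ¬ ∃ c, ∀ y, SetModel.RankLE y a → SetModel.Mem y c) inferInstance
    ⟨x, hproper x hxWF⟩
  have haWF : a ∈ SetModel.WF M := SetModel.mem_WF_of_forall fun b hb => by
    by_contra hbWF
    exact hmin b hb (hproper b hbWF)
  obtain ⟨s, hs, hxs⟩ := hZF.exists_cardLE_subset hWO hDC (fun y => SetModel.RankLE y a)
    inferInstance ha x
  exact (hx s (SetModel.mem_WF_of_forall fun y hy => hZF.mem_WF_of_rankLE haWF (hs y hy))).2 hxs
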